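/- Write $e(z)=e^{2\pi i z}$ and let $\mathbb H$ be the complex upper half plane. For an integer $k$ and positive integers $m,N$, let $J_{k,m}(N)$ be the space of Jacobi forms of weight $k$, index $m$ and level $N$, that is, of holomorphic functions $\phi:\mathbb H\times\mathbb C\to\mathbb C$ such that (1) $\phi\left(\frac{a\tau+b}{c\tau+d},\frac{z}{c\tau+d}\right)(c\tau+d)^{-k}e\left(\frac{-mcz^2}{c\tau+d}\right)=\phi(\tau,z)$ for all $\begin{pmatrix}a&b\\c&d\end{pmatrix}\in\Gamma_0(N)$; (2) $\phi(\tau,z+\lambda\tau+\mu)\,e\left(m(\lambda^2\tau+2\lambda z)\right)=\phi(\tau,z)$ for all $(\lambda,\mu)\in\mathbb Z^2$; (3) for every $\begin{pmatrix}a&b\\c&d\end{pmatrix}\in \mathrm{SL}(2,\mathbb Z)$, the left-hand side of (1) has a Fourier expansion $\sum_{n\in\frac1N\mathbb Z,\ r\in\mathbb Z}c(n,r)\,e(n\tau)\,e(rz)$ in which $c(n,r)=0$ unless $4nm-r^2\ge 0$. Every $\phi\in J_{k,m}(N)$ has a unique theta expansion $\phi(\tau,z)=\sum_{\mu \bmod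 2m}h_\mu(\tau)\,\Theta_{\mu,m}(\tau,z)$, where $\Theta_{\mu,m}(\tau,z)=\sum_{n\in\mathbb Z}e\left(\frac{(2mn-\mu)^2}{4m}\tau+(2mn-\mu)z\right)$; the functions $h_\mu:\mathbb H\to\mathbb C$ are called the theta components of $\phi$. Theorem. Let $N$ be an odd positive integer and let $m_1,m_2$ be square-free positive integers with $m_1\mid N$ and $(N,m_2)=1$. For every integer $k$ and every non-zero $\phi\in J_{k,m_1m_2}(N)$ there exists $\mu \bmod 2m_1m_2$ with either $(\mu,2m_1m_2)=1$ or $(\mu,2m_1m_2)\nmid 2m_2$ such that the theta component $h_\mu$ of $\phi$ is not identically zero. -/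

import Mathlib

open scoped UpperHalfPlane MatrixGroups

noncomputable section

namespace LevelJacobi

/-- `e(z) = exp(2πiz)`. -/
def e (z : ℂ) : ℂ := Complex.exp (2 * (Real.pi : ℂ) * Complex.I * z)

/-- The action of weight `k` and index `m` of `γ = (a b; c d) ∈ SL(2, ℤ)`:
`(φ|γ)(τ, z) = φ((aτ+b)/(cτ+d), z/(cτ+d)) (cτ+d)^{-k} e(-mcz²/(cτ+d))`. -/
def slash (k : ℤ) (m : ℕ) (γ : SL(2, ℤ)) (φ : ℍ → ℂ → ℂ) (τ : ℍ) (z : ℂ) : ℂ :=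
  φ (γ • τ) (z / ((γ 1 0 : ℂ) * (τ : ℂ) + (γ 1 1 : ℂ)))
    * ((γ 1 0 : ℂ) * (τ : ℂ) + (γ 1 1 : ℂ)) ^ (-k)
    * e ((m : ℂ) * (-(γ 1 0 : ℂ) * z ^ 2 / ((γ 1 0 : ℂ) * (τ : ℂ) + (γ 1 1 : ℂ))))

/-- `φ ∈ J_{k,m}(N)`: `φ` is a Jacobi form of weight `k` and index `m` for `Γ₀(N)`. -/
structure IsJacobiForm (k : ℤ) (m N : ℕ) (φ : ℍ → ℂ → ℂ) : Prop where
  /-- `φ` is holomorphic on `ℍ × ℂ`. -/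
  holo : DifferentiableOn ℂ (fun p : ℂ × ℂ => φ (UpperHalfPlane.ofComplex p.1) p.2)
    {p : ℂ × ℂ | 0 < p.1.im}
  /-- Invariance under `Γ₀(N)`. -/
  slash_eq : ∀ γ ∈ CongruenceSubgroup.Gamma0 N, ∀ (τ : ℍ) (z : ℂ), slash k m γ φ τ z = φ τ z
  /-- Invariance under `ℤ²`. -/
  translate_eq : ∀ (l n : ℤ) (τ : ℍ) (z : ℂ),
    φ τ (z + (l : ℂ) * (τ : ℂ) + (n : ℂ))
      * e ((m : ℂ) * ((l : ℂ) ^ 2 * (τ : ℂ) + 2 * (l : ℂ) * z)) = φ τ z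
  /-- Boundedness at the cusps: for every `γ ∈ SL(2, ℤ)`, `φ|γ` has a Fourier expansion
  `∑ c(n, r) e(nτ/N) e(rz)` supported on `4 (n/N) m - r² ≥ 0`. -/
  bdd_at_cusps : ∀ γ : SL(2, ℤ), ∃ c : ℤ × ℤ → ℂ,
    (∀ n r : ℤ, c (n, r) ≠ 0 → 0 ≤ 4 * n * (m : ℤ) - (N : ℤ) * r ^ 2) ∧
    ∀ (τ : ℍ) (z : ℂ),
      HasSum (fun p : ℤ × ℤ =>
          c p * e ((p.1 : ℂ) * (τ : ℂ) / (N : ℂ)) * e ((p.2 : ℂ) * z))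
        (slash k m γ φ τ z)

/-- The theta series
`Θ_{μ,m}(τ, z) = ∑_{n ∈ ℤ} e((2mn - μ)² τ / (4m) + (2mn - μ) z)`. -/
def theta (m : ℕ) (μ : ℤ) (τ : ℍ) (z : ℂ) : ℂ :=
  ∑' n : ℤ, e ((2 * (m : ℂ) * (n : ℂ) - (μ : ℂ)) ^ 2 / (4 * (m : ℂ)) * (τ : ℂ)
    + (2 * (m : ℂ) * (n : ℂ) - (μ : ℂ)) * z)

/-- `(h_μ)`, indexed by the residues `0 ≤ μ < 2m`, is the family of theta components of `φ`:
`φ(τ, z) = ∑_{μ mod 2m} h_μ(τ) Θ_{μ,m}(τ, z)`. -/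
def IsThetaExpansion (m : ℕ) (φ : ℍ → ℂ → ℂ) (h : Fin (2 * m) → ℍ → ℂ) : Prop :=
  ∀ (τ : ℍ) (z : ℂ), φ τ z = ∑ μ : Fin (2 * m), h μ τ * theta m ((μ : ℕ) : ℤ) τ z

end LevelJacobi

end

/-!
The theta expansion is the Fourier expansion of `φ(τ, ·)`: invariance under `z ↦ z + τ` makes the
`r`-th coefficient, divided by `e(r²τ/4m)`, depend only on `r` modulo `2m`, and Fourier coefficients
are unique (`eq_zero_of_hasSum_fourier`).

For the non-vanishing, let `m = m₁ m₂`. It suffices to find `μ` with `h_μ ≠ 0` that is prime to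
`2 m₂`: if `(μ, 2m)` divides `2 m₂`, it is then `1`. Such a `μ` is found by sieving out the primes
`p ∣ 2 m₂` one at a time. Since `Θ_μ(τ, z + j/p) = e(-μj/p) Θ_μ(τ, z)`, the average of a function
over its translates by `j/p` keeps exactly the components with `p ∣ μ`, and subtracting it removes
them. The difference is still invariant under the translations by `ℤτ + ℤ`, and under those matrices
of the group that have lower row `(0, 1)` modulo `p²`, because they preserve the translations by
`1/p` (`IsInvariant.sub_average`).

What must be excluded is that nothing remains after the sieving by `p`, in which case `ψ` is
invariant under `z ↦ z + 1/p` (`IsInvariant.eq_zero_of_periodic`). Let `M` be the product of the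
squares of the primes already used. The matrices `(1 0; c 1)` and `(1 1; c c+1)` with `c = NM` leave
`ψ` invariant, and they carry `z ↦ z + 1/p` to transformation laws under `z ↦ z + (cτ + 1)/p` and
`z ↦ z + (cτ + c + 1)/p`. Modulo the period `1/p` these are the same translation, but the factors
differ by `e(-mc²/p²)`. As `p` divides neither `N` nor `M`, and `m` is square-free, this is not `1`,
so `ψ = 0`.
-/

namespace LevelJacobi

open UpperHalfPlane

/-! ### The exponential -/

theorem e_add (x y : ℂ) : e (x + y) = e x * e y := by
  simp only [e, ← Complex.exp_add]; ring_nf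

theorem e_ne_zero (x : ℂ) : e x ≠ 0 := Complex.exp_ne_zero _

theorem e_zero : e 0 = 1 := by simp [e]

theorem e_eq_one_iff (x : ℂ) : e x = 1 ↔ ∃ n : ℤ, x = n := by
  have h0 : (2 * (Real.pi : ℂ) * Complex.I) ≠ 0 := Complex.two_pi_I_ne_zero
  rw [e, Complex.exp_eq_one_iff]
  refine exists_congr fun n => ⟨fun h => ?_, fun h => ?_⟩
  · apply mul_left_cancel₀ h0
    rw [h]; ring
  · rw [h]; ring

theorem e_int (n : ℤ) : e n = 1 := (e_eq_one_iff _).2 ⟨n, rfl⟩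

theorem e_add_int (x : ℂ) (n : ℤ) : e (x + n) = e x := by rw [e_add, e_int, mul_one]

theorem e_natCast_mul (n : ℕ) (x : ℂ) : e (n * x) = e x ^ n := by
  rw [e, e, ← Complex.exp_nat_mul]; ring_nf

theorem e_div_eq_one_iff {n : ℕ} (hn : n ≠ 0) (a : ℤ) : e (a / n) = 1 ↔ (n : ℤ) ∣ a := by
  have hn' : (n : ℂ) ≠ 0 := Nat.cast_ne_zero.2 hn
  rw [e_eq_one_iff]
  refine exists_congr fun k => ?_
  rw [div_eq_iff hn', mul_comm]
  exact_mod_cast Iff.rfl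

theorem norm_e_ofReal (x : ℝ) : ‖e x‖ = 1 := by
  rw [e, show 2 * (Real.pi : ℂ) * Complex.I * x = ((2 * Real.pi * x : ℝ) : ℂ) * Complex.I by
    push_cast; ring]
  exact Complex.norm_exp_ofReal_mul_I _

theorem integral_e_int_mul {n : ℤ} (hn : n ≠ 0) : ∫ x in (0 : ℝ)..1, e (n * (x : ℂ)) = 0 := by
  have hc : 2 * (Real.pi : ℂ) * Complex.I * n ≠ 0 :=
    mul_ne_zero Complex.two_pi_I_ne_zero (Int.cast_ne_zero.2 hn)
  have := integral_exp_mul_complex (a := 0) (b := 1) hc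
  have h1 : Complex.exp (2 * (Real.pi : ℂ) * Complex.I * n) = 1 := e_int n
  simp only [e, ← mul_assoc]
  rw [this]
  simp [h1]

/-! ### Uniqueness of Fourier coefficients -/

/-- An everywhere convergent Fourier series on `ℝ` with sum `0` has zero coefficients; convergence at
`x = 0` already gives absolute convergence, so that it may be integrated term by term. -/
theorem eq_zero_of_hasSum_fourier {a : ℤ → ℂ}
    (h : ∀ x : ℝ, HasSum (fun r : ℤ => a r * e (r * (x : ℂ))) 0) : a = 0 := by
  have hs : Summable fun r => ‖a r‖ := by
    have := (h 0).summable.norm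
    simpa [e_zero] using this
  funext s
  have hcont (r : ℤ) : Continuous fun x : ℝ => a r * e (((r - s : ℤ) : ℂ) * (x : ℂ)) := by
    unfold e; fun_prop
  have key := intervalIntegral.hasSum_intervalIntegral_of_summable_norm (a := 0) (b := 1)
    (f := fun r : ℤ => (⟨fun x : ℝ => a r * e (((r - s : ℤ) : ℂ) * (x : ℂ)), hcont r⟩ : C(ℝ, ℂ)))
    (by
      refine Summable.of_nonneg_of_le (fun _ => norm_nonneg _) (fun r => ?_) hs
      refine (ContinuousMap.norm_le _ (norm_nonneg _)).2 fun x => ?_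
      have := norm_e_ofReal (((r - s : ℤ) : ℝ) * (x : ℝ))
      push_cast at this
      simp [this])
  have hsum (x : ℝ) : ∑' r : ℤ, a r * e (((r - s : ℤ) : ℂ) * (x : ℂ)) = 0 := by
    have := ((h x).mul_right (e (((-s : ℤ) : ℂ) * x))).tsum_eq
    rw [zero_mul] at this
    rw [← this]
    refine tsum_congr fun r => ?_
    rw [mul_assoc, ← e_add]; push_cast; ring_nf
  simp only [ContinuousMap.coe_mk, hsum, intervalIntegral.integral_zero,
    intervalIntegral.integral_const_mul] at key
  have key' := hasSum_single (f := fun r : ℤ =>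
    a r * ∫ x in (0 : ℝ)..1, e (((r - s : ℤ) : ℂ) * (x : ℂ))) s fun r hr => by
      rw [integral_e_int_mul (sub_ne_zero.2 hr), mul_zero]
  have := key.unique key'
  simpa [e_zero] using this.symm

theorem hasSum_fourier_injective {a b : ℤ → ℂ} {f : ℂ → ℂ}
    (ha : ∀ z, HasSum (fun r : ℤ => a r * e (r * z)) (f z))
    (hb : ∀ z, HasSum (fun r : ℤ => b r * e (r * z)) (f z)) : a = b := by
  refine sub_eq_zero.1 (eq_zero_of_hasSum_fourier fun x => ?_)
  simpa [sub_mul] using (ha x).sub (hb x)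

/-! ### Theta series -/

theorem summable_theta {m : ℕ} (hm : m ≠ 0) (μ : ℤ) (τ : ℍ) (z : ℂ) :
    Summable fun n : ℤ => e ((2 * (m : ℂ) * (n : ℂ) - (μ : ℂ)) ^ 2 / (4 * (m : ℂ)) * (τ : ℂ)
      + (2 * (m : ℂ) * (n : ℂ) - (μ : ℂ)) * z) := by
  have hm' : (m : ℂ) ≠ 0 := Nat.cast_ne_zero.2 hm
  have him : 0 < (2 * (m : ℂ) * (τ : ℂ)).im := by
    have : 0 < (m : ℝ) := by positivity
    have := mul_pos (mul_pos two_pos this) τ.im_pos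
    simpa using this
  have := ((summable_jacobiTheta₂_term_iff (2 * m * z - μ * τ) (2 * m * τ)).2 him).mul_left
    (e ((μ : ℂ) ^ 2 / (4 * m) * τ - μ * z))
  refine this.congr fun n => ?_
  rw [jacobiTheta₂_term, e, e, ← Complex.exp_add]
  congr 1
  field_simp
  ring

/-- Writing `r = 2mn - μ` with `0 ≤ μ < 2m` enumerates the integers. -/
def residueEquiv (m : ℕ) [NeZero (2 * m)] : Fin (2 * m) × ℤ ≃ ℤ :=
  ((Equiv.prodComm _ _).trans ((Equiv.neg ℤ).prodCongr (Equiv.refl _))).trans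
    ((Int.divModEquiv (2 * m)).symm.trans (Equiv.neg ℤ))

theorem residueEquiv_apply (m : ℕ) [NeZero (2 * m)] (μ : Fin (2 * m)) (n : ℤ) :
    residueEquiv m (μ, n) = 2 * m * n - (μ : ℕ) := by
  simp [residueEquiv, Int.divModEquiv]
  ring

/-- The Fourier expansion in `z` of a linear combination of theta series. -/
theorem hasSum_theta {m : ℕ} (hm : m ≠ 0) (b : Fin (2 * m) → ℂ) (B : ℤ → ℂ)
    (hB : ∀ (μ : Fin (2 * m)) (n : ℤ), B (2 * m * n - (μ : ℕ)) = b μ) (τ : ℍ) (z : ℂ) :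
    HasSum (fun r : ℤ => B r * e ((r : ℂ) ^ 2 / (4 * m) * τ) * e (r * z))
      (∑ μ : Fin (2 * m), b μ * theta m ((μ : ℕ) : ℤ) τ z) := by
  have : NeZero (2 * m) := ⟨by omega⟩
  rw [← (residueEquiv m).hasSum_iff]
  have hterm (μ : Fin (2 * m)) (n : ℤ) :
      ((fun r : ℤ => B r * e ((r : ℂ) ^ 2 / (4 * m) * τ) * e (r * z)) ∘ residueEquiv m) (μ, n)
      = b μ * e ((2 * (m : ℂ) * (n : ℂ) - (((μ : ℕ) : ℤ) : ℂ)) ^ 2 / (4 * (m : ℂ)) * (τ : ℂ)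
        + (2 * (m : ℂ) * (n : ℂ) - (((μ : ℕ) : ℤ) : ℂ)) * z) := by
    rw [Function.comp_apply, residueEquiv_apply, hB, e_add, mul_assoc]
    push_cast
    rfl
  have hs : Summable ((fun r : ℤ => B r * e ((r : ℂ) ^ 2 / (4 * m) * τ) * e (r * z)) ∘
      residueEquiv m) := by
    refine Summable.of_norm ((summable_prod_of_nonneg fun _ => norm_nonneg _).2
      ⟨fun μ => ?_, Summable.of_finite⟩)
    simp only [hterm]
    exact ((summable_theta hm _ τ z).mul_left (b μ)).norm
  have hfib := hs.hasSum.prod_fiberwise fun μ => by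
    simp only [hterm]
    exact (summable_theta hm _ τ z).hasSum.mul_left (b μ)
  have := hfib.unique (hasSum_fintype _)
  rw [show (∑ μ : Fin (2 * m), b μ * theta m ((μ : ℕ) : ℤ) τ z) = _ from this.symm]
  exact hs.hasSum

/-- The theta series `Θ_{μ,m}(τ, ·)`, for `0 ≤ μ < 2m`, are linearly independent. -/
theorem theta_independent {m : ℕ} (hm : m ≠ 0) {b b' : Fin (2 * m) → ℂ} {τ : ℍ}
    (h : ∀ z, ∑ μ : Fin (2 * m), b μ * theta m ((μ : ℕ) : ℤ) τ z
      = ∑ μ : Fin (2 * m), b' μ * theta m ((μ : ℕ) : ℤ) τ z) : b = b' := by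
  have : NeZero (2 * m) := ⟨by omega⟩
  have hB (b : Fin (2 * m) → ℂ) (μ : Fin (2 * m)) (n : ℤ) :
      (fun r => b ((residueEquiv m).symm r).1) (2 * m * n - (μ : ℕ)) = b μ := by
    simp only [← residueEquiv_apply, Equiv.symm_apply_apply]
  have key := hasSum_fourier_injective
    (fun z => hasSum_theta hm b (fun r => b ((residueEquiv m).symm r).1) (hB b) τ z)
    (fun z => (h z).symm ▸ hasSum_theta hm b' (fun r => b' ((residueEquiv m).symm r).1) (hB b') τ z)
  funext μ
  have := mul_right_cancel₀ (e_ne_zero _) (congrFun key (residueEquiv m (μ, 0)))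
  simpa using this

theorem theta_add_div {m p : ℕ} (hp : p ≠ 0) (hpm : p ∣ 2 * m) (μ : ℤ) (τ : ℍ) (z : ℂ) (j : ℕ) :
    theta m μ τ (z + j / p) = e ((-μ : ℤ) / p) ^ j * theta m μ τ z := by
  obtain ⟨q, hq⟩ := hpm
  have hp' : (p : ℂ) ≠ 0 := Nat.cast_ne_zero.2 hp
  have hq' : 2 * (m : ℂ) = p * q := by exact_mod_cast hq
  rw [theta, theta, ← tsum_mul_left]
  refine tsum_congr fun n => ?_
  rw [← e_natCast_mul, ← e_add, ← e_add_int (j * _ + _) (q * n * j)]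
  congr 1
  simp only [hq']
  push_cast
  field_simp
  ring

/-- Averaging over the translates by `j/p` keeps `Θ_μ` if `p ∣ μ` and kills it otherwise. -/
theorem sum_theta_add_div {m p : ℕ} (hp : p ≠ 0) (hpm : p ∣ 2 * m) (μ : ℤ) (τ : ℍ) (z : ℂ) :
    ∑ j ∈ Finset.range p, theta m μ τ (z + j / p)
      = if (p : ℤ) ∣ μ then p * theta m μ τ z else 0 := by
  have hp' : (p : ℂ) ≠ 0 := Nat.cast_ne_zero.2 hp
  simp only [theta_add_div hp hpm, ← Finset.sum_mul]
  have h1 := e_div_eq_one_iff hp (-μ)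
  rw [dvd_neg] at h1
  split_ifs with h
  · rw [h1.2 h]
    simp
  · have hpow : e ((-μ : ℤ) / p) ^ p = 1 := by
      rw [← e_natCast_mul, mul_div_cancel₀ _ hp', e_int]
    have hg := mul_geom_sum (e ((-μ : ℤ) / p)) p
    rw [hpow, sub_self] at hg
    rw [(mul_eq_zero.1 hg).resolve_left (sub_ne_zero.2 fun h2 => h (h1.1 h2)), zero_mul]

/-! ### Existence and uniqueness of the theta expansion -/

theorem IsJacobiForm.exists_fourier {k : ℤ} {m N : ℕ} {φ : ℍ → ℂ → ℂ} (hφ : IsJacobiForm k m N φ)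
    (τ : ℍ) : ∃ g : ℤ → ℂ, ∀ z, HasSum (fun r : ℤ => g r * e (r * z)) (φ τ z) := by
  obtain ⟨c, -, hc⟩ := hφ.bdd_at_cusps 1
  have hc' (z : ℂ) : HasSum (fun p : ℤ × ℤ =>
      c p.swap * e ((p.2 : ℂ) * (τ : ℂ) / (N : ℂ)) * e ((p.1 : ℂ) * z)) (φ τ z) := by
    have h := hc τ z
    have h1 : slash k m 1 φ τ z = φ τ z := by
      simp [slash, e_zero]
    rw [h1, ← (Equiv.prodComm ℤ ℤ).hasSum_iff] at h
    exact h
  have hs : Summable fun p : ℤ × ℤ => c p.swap * e ((p.2 : ℂ) * (τ : ℂ) / (N : ℂ)) := by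
    simpa [e_zero] using (hc' 0).summable
  exact ⟨fun r => ∑' n : ℤ, c (n, r) * e ((n : ℂ) * (τ : ℂ) / (N : ℂ)), fun z =>
    (hc' z).prod_fiberwise fun r => (hs.prod_factor r).hasSum.mul_right _⟩

theorem IsJacobiForm.exists_thetaExpansion {k : ℤ} {m N : ℕ} (hm : m ≠ 0) {φ : ℍ → ℂ → ℂ}
    (hφ : IsJacobiForm k m N φ) (τ : ℍ) : ∃ b : Fin (2 * m) → ℂ, ∀ z,
      φ τ z = ∑ μ : Fin (2 * m), b μ * theta m ((μ : ℕ) : ℤ) τ z := by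
  have hm' : (m : ℂ) ≠ 0 := Nat.cast_ne_zero.2 hm
  obtain ⟨g, hg⟩ := hφ.exists_fourier τ
  -- Comparing Fourier coefficients in the invariance under `z ↦ z + τ`.
  have hrec (r : ℤ) : g (r - 2 * m) * e ((r - m) * τ) = g r := by
    refine congrFun (hasSum_fourier_injective
      (a := fun r : ℤ => g (r - 2 * m) * e ((r - m) * τ)) (fun z => ?_) hg) r
    have h1 := (hg (z + τ)).mul_right (e (m * (τ + 2 * z)))
    have h2 := hφ.translate_eq 1 0 τ z
    simp only [Int.cast_one, Int.cast_zero, one_mul, one_pow, mul_one, add_zero] at h2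
    rw [h2, ← (Equiv.subRight (2 * m : ℤ)).hasSum_iff] at h1
    refine h1.congr_fun fun r => ?_
    simp only [Function.comp_apply, Equiv.subRight_apply]
    rw [mul_assoc, mul_assoc, ← e_add, ← e_add]
    push_cast
    ring_nf
  have hper : Function.Periodic (fun r : ℤ => g r * e (-((r : ℂ) ^ 2 / (4 * m) * τ))) (2 * m) := by
    intro r
    have := hrec (r + 2 * m)
    rw [add_sub_cancel_right] at this
    simp only [← this]
    rw [mul_assoc, ← e_add]
    congr 2
    push_cast
    field_simp
    ring
  refine ⟨fun μ => g (-(μ : ℕ)) * e (-((((-(μ : ℕ)) : ℤ) : ℂ) ^ 2 / (4 * m) * τ)), fun z => ?_⟩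
  have h := hasSum_theta hm
    (fun μ => g (-(μ : ℕ)) * e (-((((-(μ : ℕ)) : ℤ) : ℂ) ^ 2 / (4 * m) * τ)))
    (fun r : ℤ => g r * e (-((r : ℂ) ^ 2 / (4 * m) * τ))) (fun μ n => ?_) τ z
  · refine (hg z).unique (h.congr_fun fun r => ?_)
    rw [mul_assoc (g r), ← e_add, neg_add_cancel, e_zero, mul_one]
  · have := (hper.int_mul n) (-(μ : ℕ))
    rw [Int.cast_id, show (-(μ : ℕ) + n * (2 * m) : ℤ) = 2 * m * n - (μ : ℕ) by ring] at this
    exact this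

theorem IsJacobiForm.existsUnique_thetaExpansion {k : ℤ} {m N : ℕ} (hm : m ≠ 0) {φ : ℍ → ℂ → ℂ}
    (hφ : IsJacobiForm k m N φ) : ∃! h : Fin (2 * m) → ℍ → ℂ, IsThetaExpansion m φ h := by
  choose b hb using hφ.exists_thetaExpansion hm
  refine ⟨fun μ τ => b τ μ, hb, fun h hh => ?_⟩
  funext μ τ
  exact congrFun (theta_independent hm (b := fun μ => h μ τ) (b' := b τ)
    fun z => (hh τ z).symm.trans (hb τ z)) μ

/-! ### Sieving the theta components by a prime -/

/-- The part of the Jacobi transformation law that survives sieving: `ψ` has index `m`, and it is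
invariant in weight `k` under the matrices of `Γ₀(N)` whose lower row is `(0, 1)` modulo `M`. -/
structure IsInvariant (k : ℤ) (m N M : ℕ) (ψ : ℍ → ℂ → ℂ) : Prop where
  slash_eq : ∀ γ : SL(2, ℤ), (N : ℤ) ∣ γ 1 0 → (M : ℤ) ∣ γ 1 0 → (M : ℤ) ∣ γ 1 1 - 1 →
    ∀ (τ : ℍ) (z : ℂ), slash k m γ ψ τ z = ψ τ z
  translate_eq : ∀ (l n : ℤ) (τ : ℍ) (z : ℂ),
    ψ τ (z + (l : ℂ) * (τ : ℂ) + (n : ℂ))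
      * e ((m : ℂ) * ((l : ℂ) ^ 2 * (τ : ℂ) + 2 * (l : ℂ) * z)) = ψ τ z

theorem IsJacobiForm.isInvariant {k : ℤ} {m N : ℕ} {φ : ℍ → ℂ → ℂ} (hφ : IsJacobiForm k m N φ) :
    IsInvariant k m N 1 φ where
  slash_eq γ hγ _ _ := hφ.slash_eq γ
    (CongruenceSubgroup.Gamma0_mem.2 ((ZMod.intCast_zmod_eq_zero_iff_dvd _ _).2 hγ))
  translate_eq := hφ.translate_eq

/-- The average of the translates `ψ(τ, z + j/p)`: it keeps the theta components `h_μ` with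
`p ∣ μ` and kills the others. -/
noncomputable def average (p : ℕ) (ψ : ℍ → ℂ → ℂ) (τ : ℍ) (z : ℂ) : ℂ :=
  (p : ℂ)⁻¹ * ∑ j ∈ Finset.range p, ψ τ (z + j / p)

theorem denom_ne (γ : SL(2, ℤ)) (τ : ℍ) : (γ 1 0 : ℂ) * (τ : ℂ) + (γ 1 1 : ℂ) ≠ 0 := by
  have := UpperHalfPlane.denom_ne_zero (γ : GL (Fin 2) ℝ) τ
  simpa [UpperHalfPlane.denom] using this

/-- A matrix with lower row `(0, 1)` modulo `p ^ 2` maps the translation by `j/p` to itself up to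
translations by `ℤτ + ℤ`, hence it also fixes the translates of `ψ`. -/
theorem IsInvariant.slash_shift {k : ℤ} {m N M p : ℕ} (hp : p ≠ 0)
    {ψ : ℍ → ℂ → ℂ} (hψ : IsInvariant k m N M ψ) (γ : SL(2, ℤ)) (hN : (N : ℤ) ∣ γ 1 0)
    (hM : ((M * p ^ 2 : ℕ) : ℤ) ∣ γ 1 0) (hM' : ((M * p ^ 2 : ℕ) : ℤ) ∣ γ 1 1 - 1) (j : ℕ) (τ : ℍ)
    (z : ℂ) : slash k m γ (fun τ z => ψ τ (z + j / p)) τ z = ψ τ (z + j / p) := by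
  have hp' : (p : ℂ) ≠ 0 := Nat.cast_ne_zero.2 hp
  have hMd : (M : ℤ) ∣ ((M * p ^ 2 : ℕ) : ℤ) := by exact_mod_cast Dvd.intro _ rfl
  have hJ := denom_ne γ τ
  have h1 := hψ.slash_eq γ hN (hMd.trans hM) (hMd.trans hM') τ
    (z + ((γ 1 0 : ℂ) * (τ : ℂ) + (γ 1 1 : ℂ)) * (j / p))
  obtain ⟨c, hc⟩ := hM
  obtain ⟨d, hd⟩ := hM'
  have hc' : (γ 1 0 : ℂ) = M * p ^ 2 * c := by exact_mod_cast congrArg (Int.cast : ℤ → ℂ) hc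
  have hd' : (γ 1 1 : ℂ) = M * p ^ 2 * d + 1 := by
    rw [← sub_eq_iff_eq_add]; exact_mod_cast congrArg (Int.cast : ℤ → ℂ) hd
  have h2 := hψ.translate_eq (M * p * c * j) (M * p * d * j) τ (z + j / p)
  have hz : z + ((γ 1 0 : ℂ) * (τ : ℂ) + (γ 1 1 : ℂ)) * (j / p)
      = z + j / p + ((M * p * c * j : ℤ) : ℂ) * (τ : ℂ) + ((M * p * d * j : ℤ) : ℂ) := by
    rw [hc', hd']; push_cast; field_simp; ring
  rw [hz] at h1
  rw [← h2, ← h1]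
  simp only [slash]
  rw [mul_assoc (_ * _), ← e_add]
  congr 1
  · congr 2
    rw [← hz]
    field_simp
  · -- The two exponents differ by an integer because `p ^ 2 ∣ c`.
    rw [← e_add_int (m * (-_ * z ^ 2 / _)) (m * (M * c * j ^ 2 * (1 - M * p ^ 2 * d)))]
    congr 1
    rw [← hz]
    field_simp
    rw [hc', hd']
    push_cast
    field_simp
    ring

theorem IsInvariant.sub_average {k : ℤ} {m N M p : ℕ} (hp : p ≠ 0) (hpm : p ∣ 2 * m)
    {ψ : ℍ → ℂ → ℂ} (hψ : IsInvariant k m N M ψ) :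
    IsInvariant k m N (M * p ^ 2) (fun τ z => ψ τ z - average p ψ τ z) where
  slash_eq γ hN hM hM' τ z := by
    have hMd : (M : ℤ) ∣ ((M * p ^ 2 : ℕ) : ℤ) := by exact_mod_cast Dvd.intro _ rfl
    have h0 := hψ.slash_eq γ hN (hMd.trans hM) (hMd.trans hM') τ z
    have hj (j : ℕ) := hψ.slash_shift hp γ hN hM hM' j τ z
    simp only [slash, average] at h0 hj ⊢
    rw [sub_mul, sub_mul, h0, mul_assoc, mul_assoc, Finset.sum_mul]
    simp only [← mul_assoc, hj]
  translate_eq l n τ z := by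
    have hp' : (p : ℂ) ≠ 0 := Nat.cast_ne_zero.2 hp
    obtain ⟨q, hq⟩ := hpm
    have hq' : 2 * (m : ℂ) = p * q := by exact_mod_cast hq
    have h0 := hψ.translate_eq l n τ z
    have hj (j : ℕ) : ψ τ (z + l * τ + n + j / p) * e (m * ((l : ℂ) ^ 2 * τ + 2 * l * z))
        = ψ τ (z + j / p) := by
      rw [← hψ.translate_eq l n τ (z + j / p)]
      rw [← e_add_int (m * ((l : ℂ) ^ 2 * τ + 2 * l * z)) (q * l * j)]
      congr 2
      · ring
      · push_cast
        field_simp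
        linear_combination (-(l : ℂ) * j) * hq'
    simp only [average]
    rw [sub_mul, h0, mul_assoc, Finset.sum_mul]
    simp only [hj]

theorem average_add_div {k : ℤ} {m N M p : ℕ} (hp : p ≠ 0) {ψ : ℍ → ℂ → ℂ}
    (hψ : IsInvariant k m N M ψ) (τ : ℍ) (z : ℂ) :
    average p ψ τ (z + 1 / p) = average p ψ τ z := by
  have hp' : (p : ℂ) ≠ 0 := Nat.cast_ne_zero.2 hp
  have h := (Finset.sum_range_succ (fun j : ℕ => ψ τ (z + j / p)) p).symm.trans
    (Finset.sum_range_succ' (fun j : ℕ => ψ τ (z + j / p)) p)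
  have h1 := hψ.translate_eq 0 1 τ z
  simp [e_zero] at h1
  simp only [div_self hp', h1, Nat.cast_zero, zero_div, add_zero] at h
  rw [average, average, add_right_cancel h]
  congr 1
  refine Finset.sum_congr rfl fun j _ => ?_
  congr 1
  push_cast
  ring

/-- Periodicity under `z ↦ z + 1/p` is transported by `γ` to a transformation law under
`z ↦ z + (cτ + d)/p`. -/
theorem IsInvariant.add_denom_div {k : ℤ} {m N M p : ℕ} (hp : p ≠ 0)
    {ψ : ℍ → ℂ → ℂ} (hψ : IsInvariant k m N M ψ) (hper : ∀ τ z, ψ τ (z + 1 / p) = ψ τ z)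
    (γ : SL(2, ℤ)) (hN : (N : ℤ) ∣ γ 1 0) (hM : (M : ℤ) ∣ γ 1 0) (hM' : (M : ℤ) ∣ γ 1 1 - 1)
    (τ : ℍ) (z : ℂ) :
    ψ τ (z + ((γ 1 0 : ℂ) * (τ : ℂ) + (γ 1 1 : ℂ)) / p)
      = e (-(m * γ 1 0 * (2 * z / p + ((γ 1 0 : ℂ) * (τ : ℂ) + (γ 1 1 : ℂ)) / p ^ 2))) * ψ τ z := by
  have hp' : (p : ℂ) ≠ 0 := Nat.cast_ne_zero.2 hp
  have hJ := denom_ne γ τ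
  rw [← hψ.slash_eq γ hN hM hM' τ z, ← hψ.slash_eq γ hN hM hM' τ (z + _)]
  simp only [slash]
  set J := (γ 1 0 : ℂ) * (τ : ℂ) + (γ 1 1 : ℂ)
  rw [show (z + J / p) / J = z / J + 1 / p by field_simp, hper, mul_comm (e (-_)), mul_assoc (_ * _),
    ← e_add]
  congr 2
  field_simp
  ring

/-- If `p` does not divide `N M` and `p ^ 2` does not divide `m`, then no non-zero `ψ` is invariant
under `z ↦ z + 1/p`. -/
theorem IsInvariant.eq_zero_of_periodic {k : ℤ} {m N M p : ℕ} (hp : p.Prime) (hpN : ¬ p ∣ N)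
    (hpM : ¬ p ∣ M) (hpm : ¬ p ^ 2 ∣ m) {ψ : ℍ → ℂ → ℂ} (hψ : IsInvariant k m N M ψ)
    (hper : ∀ τ z, ψ τ (z + 1 / p) = ψ τ z) : ψ = 0 := by
  have hp' : (p : ℂ) ≠ 0 := Nat.cast_ne_zero.2 hp.ne_zero
  have hpern (n : ℕ) (τ : ℍ) (z : ℂ) : ψ τ (z + n / p) = ψ τ z := by
    induction n with
    | zero => simp
    | succ n ih => rw [← ih, ← hper τ (z + n / p)]; push_cast; ring_nf
  funext τ z
  have hN : (N : ℤ) ∣ ((N * M : ℕ) : ℤ) := by exact_mod_cast Dvd.intro _ rfl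
  have hM : (M : ℤ) ∣ ((N * M : ℕ) : ℤ) := by exact_mod_cast Dvd.intro_left _ rfl
  -- Both matrices have lower left entry `c = N M`, so they give the same translation up to
  -- a multiple of `1/p`; the resulting factors differ by `e(-m c² / p²) ≠ 1`.
  have h1 := hψ.add_denom_div hp.ne_zero hper
    ⟨!![1, 0; ((N * M : ℕ) : ℤ), 1], by simp⟩ (by simp) (by simp) (by simp) τ z
  have h2 := hψ.add_denom_div hp.ne_zero hper
    ⟨!![1, 1; ((N * M : ℕ) : ℤ), ((N * M : ℕ) : ℤ) + 1], by simp⟩ (by simp)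
    (by simp) (by simp) τ z
  simp only [Matrix.of_apply, Matrix.cons_val', Matrix.cons_val_zero, Matrix.cons_val_one,
    Matrix.cons_val_fin_one, Int.cast_natCast, Int.cast_add, Int.cast_one] at h1 h2
  generalize hc : N * M = c at *
  rw [show z + ((c : ℂ) * τ + (c + 1)) / p = z + ((c : ℂ) * τ + 1) / p + c / p by ring, hpern, h1,
    show -((m : ℂ) * c * (2 * z / p + (c * τ + (c + 1)) / p ^ 2))
      = -(m * c * (2 * z / p + (c * τ + 1) / p ^ 2)) + ((-(m * c ^ 2) : ℤ) : ℂ) / ((p ^ 2 : ℕ) : ℂ) by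
    push_cast; ring, e_add, mul_assoc (e _)] at h2
  have h3 := mul_left_cancel₀ (e_ne_zero _) h2
  by_contra hz
  have h4 : e (((-(m * c ^ 2) : ℤ) : ℂ) / ((p ^ 2 : ℕ) : ℂ)) = 1 :=
    mul_right_cancel₀ hz (by rw [one_mul]; exact h3.symm)
  rw [e_div_eq_one_iff (pow_ne_zero 2 hp.ne_zero), dvd_neg] at h4
  have h5 : p ^ 2 ∣ m * c ^ 2 := by exact_mod_cast h4
  have hpc : Nat.Coprime p c := by
    rw [hp.coprime_iff_not_dvd, ← hc, hp.dvd_mul]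
    tauto
  exact hpm ((Nat.Coprime.pow 2 2 hpc).dvd_of_dvd_mul_right h5)

theorem IsThetaExpansion.sub_average {m p : ℕ} (hp : p ≠ 0) (hpm : p ∣ 2 * m) {ψ : ℍ → ℂ → ℂ}
    {h : Fin (2 * m) → ℍ → ℂ} (hh : IsThetaExpansion m ψ h) :
    IsThetaExpansion m (fun τ z => ψ τ z - average p ψ τ z)
      (fun μ τ => if p ∣ (μ : ℕ) then 0 else h μ τ) := by
  have hp' : (p : ℂ) ≠ 0 := Nat.cast_ne_zero.2 hp
  intro τ z
  simp only [average, hh τ _]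
  rw [Finset.sum_comm, Finset.mul_sum, ← Finset.sum_sub_distrib]
  refine Finset.sum_congr rfl fun μ _ => ?_
  rw [← Finset.mul_sum, sum_theta_add_div hp hpm]
  simp only [Int.natCast_dvd_natCast]
  split_ifs
  · field_simp
    ring
  · ring

/-- A non-zero `φ` has a non-zero theta component whose index is prime to a given finite set of
primes `p ∣ 2m` that do not divide `N` and whose squares do not divide `m`. -/
theorem IsInvariant.exists_sieved {k : ℤ} {m N : ℕ} {φ : ℍ → ℂ → ℂ} (hφ : IsInvariant k m N 1 φ)
    (hφ0 : φ ≠ 0) {h : Fin (2 * m) → ℍ → ℂ} (hh : IsThetaExpansion m φ h) (Q : Finset ℕ)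
    (hQ : ∀ p ∈ Q, p.Prime ∧ p ∣ 2 * m ∧ ¬ p ∣ N ∧ ¬ p ^ 2 ∣ m) :
    ∃ ψ h', IsInvariant k m N (∏ p ∈ Q, p ^ 2) ψ ∧ ψ ≠ 0 ∧ IsThetaExpansion m ψ h' ∧
      ∀ μ, h' μ ≠ 0 → h μ ≠ 0 ∧ ∀ p ∈ Q, ¬ p ∣ (μ : ℕ) := by
  induction Q using Finset.induction_on with
  | empty => exact ⟨φ, h, by simpa using hφ, hφ0, hh, by simp⟩
  | insert p Q hpQ ih =>
    obtain ⟨ψ, h', hψ, hψ0, hh', hsupp⟩ := ih fun q hq => hQ q (Finset.mem_insert_of_mem hq)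
    obtain ⟨hp, hpm, hpN, hpm2⟩ := hQ p (Finset.mem_insert_self _ _)
    have hpM : ¬ p ∣ ∏ q ∈ Q, q ^ 2 := by
      rw [hp.prime.dvd_finsetProd_iff]
      rintro ⟨q, hq, hpq⟩
      rw [(Nat.prime_dvd_prime_iff_eq hp (hQ q (Finset.mem_insert_of_mem hq)).1).1
        (hp.dvd_of_dvd_pow hpq)] at hpQ
      exact hpQ hq
    refine ⟨_, _, ?_, fun h0 => hψ0 ?_, hh'.sub_average hp.ne_zero hpm, fun μ hμ => ?_⟩
    · rw [Finset.prod_insert hpQ, mul_comm]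
      exact hψ.sub_average hp.ne_zero hpm
    · have hav (τ : ℍ) (z : ℂ) : ψ τ z = average p ψ τ z :=
        sub_eq_zero.1 (congrFun (congrFun h0 τ) z)
      exact hψ.eq_zero_of_periodic hp hpN hpM hpm2 fun τ z => by
        rw [hav, average_add_div hp.ne_zero hψ, ← hav]
    · have hpμ : ¬ p ∣ (μ : ℕ) := fun hd => hμ (by funext τ; simp [hd])
      have hμ' : h' μ ≠ 0 := fun h0 => hμ (by funext τ; simp [h0])
      refine ⟨(hsupp μ hμ').1, fun q hq => ?_⟩
      rcases Finset.mem_insert.1 hq with rfl | hq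
      · exact hpμ
      · exact (hsupp μ hμ').2 q hq

theorem IsThetaExpansion.exists_ne_zero {m : ℕ} {ψ : ℍ → ℂ → ℂ} {h : Fin (2 * m) → ℍ → ℂ}
    (hh : IsThetaExpansion m ψ h) (hψ : ψ ≠ 0) : ∃ μ, h μ ≠ 0 := by
  by_contra! h0
  refine hψ ?_
  funext τ z
  simp [hh τ z, h0]

end LevelJacobi

theorem theorem1 (k : ℤ) (N m₁ m₂ : ℕ) (hN : Odd N) (hm₁ : Squarefree m₁) (hm₂ : Squarefree m₂)
    (hdvd : m₁ ∣ N) (hcop : Nat.Coprime N m₂) (φ : UpperHalfPlane → ℂ → ℂ)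
    (hφ : LevelJacobi.IsJacobiForm k (m₁ * m₂) N φ) (hφ0 : φ ≠ 0) :
    (∃! h : Fin (2 * (m₁ * m₂)) → UpperHalfPlane → ℂ,
      LevelJacobi.IsThetaExpansion (m₁ * m₂) φ h) ∧
    ∀ h : Fin (2 * (m₁ * m₂)) → UpperHalfPlane → ℂ,
      LevelJacobi.IsThetaExpansion (m₁ * m₂) φ h →
      ∃ μ : Fin (2 * (m₁ * m₂)),
        (Nat.gcd (μ : ℕ) (2 * m₁ * m₂) = 1 ∨ ¬ Nat.gcd (μ : ℕ) (2 * m₁ * m₂) ∣ 2 * m₂) ∧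
        h μ ≠ 0 := by
  refine ⟨hφ.existsUnique_thetaExpansion (mul_ne_zero hm₁.ne_zero hm₂.ne_zero), fun h hh => ?_⟩
  have hm : Squarefree (m₁ * m₂) :=
    (Nat.squarefree_mul (Nat.Coprime.coprime_dvd_left hdvd hcop)).2 ⟨hm₁, hm₂⟩
  have hcop2 : Nat.Coprime N (2 * m₂) := Nat.Coprime.mul_right hN.coprime_two_right hcop
  obtain ⟨ψ, h', -, hψ0, hh', hsupp⟩ := hφ.isInvariant.exists_sieved hφ0 hh (2 * m₂).primeFactors
    fun p hp => by
      have hpp := Nat.prime_of_mem_primeFactors hp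
      have hpd := Nat.dvd_of_mem_primeFactors hp
      refine ⟨hpp, hpd.trans (mul_dvd_mul_left 2 (Dvd.intro_left _ rfl)), fun hpN => ?_,
        fun hp2 => ?_⟩
      · exact hpp.one_lt.ne' (Nat.eq_one_of_dvd_coprimes hcop2 hpN hpd)
      · exact hpp.one_lt.ne' (Nat.isUnit_iff.1 (hm p (by rwa [← sq])))
  obtain ⟨μ, hμ⟩ := hh'.exists_ne_zero hψ0
  obtain ⟨hμ0, hμp⟩ := hsupp μ hμ
  refine ⟨μ, ?_, hμ0⟩
  -- `μ` is prime to `2 m₂`, so a common divisor of `μ` and `2 m₁ m₂` that divides `2 m₂` is `1`.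
  rw [or_iff_not_imp_right, not_not]
  intro hg
  by_contra hne
  obtain ⟨p, hp, hpg⟩ := Nat.exists_prime_and_dvd hne
  exact hμp p (Nat.mem_primeFactors.2 ⟨hp, hpg.trans hg, by simp [hm₂.ne_zero]⟩)
    (hpg.trans (Nat.gcd_dvd_left _ _))
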